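/- **Setting.** There are $n=2f+1$ nodes, at most $f$ of them Byzantine, the others honest. Node $(v \bmod n)+1$ is the leader of view $v=0,1,2,\dots$ Signatures are unforgeable, the hash function is collision-free (injective), and a message sent from an honest node to an honest node is received and processed within a known bound $\Delta>0$ (standard synchrony); a message due at the moment at which a timer expires is taken into account before the timer. All nodes start in view $0$ at time $0$. Apart from these constraints the adversary controls the Byzantine nodes and all message delays. **Data.** A complete block $B$ consists of $f+1$ chunks of equal length over a field, encoded by an MDS $(n,f+1)$ code into $n$ chunks $y^1,\dots,y^n$; $H(B)$ is the Merkle root of these $n$ chunks. An identifier block of height $h$ is $I_h=(H(B_h),H(I_{h-1}))$, with $I_1=(H(B_1),\perp)$; it records its height. An identifier block $A$ extends $A'$ if $A'$ is reached from $A$ by passing to predecessors (zero or more times); every chain ends in $\perp$ (height $0$). A certificate $C_v(I)$ consists of votes for $I$ in view $v$ by $f+1$ distinct nodes; view $0$ starts with a certificate $C_0(\perp)$ given in advance. The rank of $C_v(I_h)$ is $(v,h)$, ordered lexicographically. **Steady-State phase** (an honest node $r$ in view $v$ with leader $L$; all message checks include legal format, in particular $I_h$ must contain the identifier of the block certified by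 the included certificate). *Propose:* upon obtaining $C_v(I_{h-1})$, $L$ sends $\langle \text{proposal},(r,y_h^r,I_h),v,C_v(I_{h-1})\rangle_L$ to each node $r$, for one block per height. *Re-propose:* $r$ forwards the first proposal it has of each height, and the one tailored for $r$, to all nodes. *Vote:* on $f+1$ proposals with distinct segments and the same $I_h$, $r$ decodes; if the decoded block $B$ satisfies $H(B)=H(B_h)$, $r$ stores it and broadcasts a vote for $I_h$ in view $v$. *Pre-commit:* on the first proposal of height $h+1$, which carries some $C_v(I_h)$, $r$ starts a commit-timer of length $2\Delta$. *Commit:* if $r$ is still in view $v$ when this timer reaches zero, $r$ directly commits $I_h$. Committing an identifier block commits all identifier blocks that it extends. **View-Change phase.** Evidence against the leader of view $v$ is: two legal proposals or new-view messages of view $v$ signed by it whose identifier blocks do not extend one another (in either direction); or $f+1$ proposals of view $v$ with distinct segments and the same $I_h$ whose decoding does not match $I_h$; or blame messages for view $v$ of $f+1$ nodes, where a node may blame if it has not voted $p$ times within $(3p+4)\Delta$ in the view. *Quit-view and status:* on finding evidence (or receiving a quit-view message with valid evidence) $r$ immediately broadcasts (or forwards) the quit-view message, leaves view $v$, locks a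 highest ranked certificate known to it, sends it to the leader of view $v+1$, and enters view $v+1$. *New-view:* after waiting $2\Delta$ in its view, a new leader broadcasts a new-view message with a highest ranked certificate known to it. *View-start:* on a new-view message whose certificate $C_{v''}(I)$ ranks equal to or higher than the lock of $r$, $r$ forwards the message to all nodes and broadcasts a vote for $I$ in the current view. **Theorem (Weak Safety).** In every execution, at every time: 1. if an honest node has committed (directly or indirectly) an identifier block $I_h$ and an honest node has committed an identifier block $I'_h$ of the same height, then $I_h=I'_h$; 2. for each identifier block $I_h$ committed (directly or indirectly) by an honest node, at least one honest node holds a complete block $B$ whose Merkle root $H(B)$ is the content $H(B_h)$ of $I_h$, that is, the complete block content behind $I_h$. -/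

import Mathlib

namespace Hamster

universe u w

/-! ### Data: blocks, coding, Merkle roots, identifier blocks -/

/-- The `n = 2f+1` nodes. -/
abbrev Node (f : ℕ) := Fin (2 * f + 1)

/-- The leader of view `v` (nodes are numbered from `0` here). -/
def leader (f v : ℕ) : Node f := Fin.ofNat (2 * f + 1) v

/-- A chunk: a finite sequence of symbols of the field `F`. -/
abbrev Chunk (F : Type u) := Σ l : ℕ, (Fin l → F)

/-- A complete block, evenly divided into `f+1` chunks of a common length. -/
abbrev Block (f : ℕ) (F : Type u) := Σ l : ℕ, (Fin (f + 1) → Fin l → F)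

/-- The identifier block `I_h = (H(B_h), H(I_{h-1}))`. The subscript `h` is recorded as a field;
`prev = none` is the symbol `⊥`, used for the first block `I_1 = (H(B_1), ⊥)`. -/
structure IdBlock (D : Type w) where
  height : ℕ
  root : D
  prev : Option D

/-- An identifier block or the empty chain `⊥` (`none`), the predecessor of first blocks. -/
abbrev Tip (D : Type w) := Option (IdBlock D)

/-- The height of a tip, with height `0` for `⊥`. -/
def tipHeight {D : Type w} (x : Tip D) : ℕ := x.elim 0 IdBlock.height

/-- What gets hashed: indexed Merkle leaves, inner Merkle nodes, identifier blocks. -/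
inductive HashInput (F : Type u) (D : Type w) where
  | leaf (i : ℕ) (y : Chunk F)
  | node (l r : D)
  | ident (I : IdBlock D)

/-- The root of the binary Merkle tree on the leaves `lo, …, lo + len - 1`. -/
def merkle {D : Type w} (node : D → D → D) (leaf : ℕ → D) (lo len : ℕ) : D :=
  if len ≤ 1 then leaf lo
  else node (merkle node leaf lo (len / 2))
    (merkle node leaf (lo + len / 2) (len - len / 2))
termination_by len
decreasing_by all_goals omega

/-- The data of a system of `2f+1` nodes: the synchronous bound, the honest nodes (all others are
Byzantine), the generator matrix of the `(2f+1, f+1)` code, and the hash function. -/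
structure Setup (f : ℕ) (F : Type u) (D : Type w) where
  Δ : ℝ
  honest : Finset (Node f)
  gen : Matrix (Node f) (Fin (f + 1)) F
  hash : HashInput F D → D

variable {f : ℕ} {F : Type u} {D : Type w}

/-- The code is MDS: any `f+1` rows of the generator matrix form an invertible matrix, so that a
block can be recovered from any `f+1` of its `2f+1` chunks. -/
def Setup.MDS [Field F] (S : Setup f F D) : Prop :=
  ∀ e : Fin (f + 1) → Node f, Function.Injective e → (S.gen.submatrix e id).det ≠ 0

/-- The `i`-th coded chunk of a block. -/
def Setup.encode [Field F] (S : Setup f F D) (B : Block f F) (i : Node f) : Chunk F :=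
  ⟨B.1, fun s => ∑ j, S.gen i j * B.2 j s⟩

/-- `H(B)`: the Merkle root of the `2f+1` coded chunks of `B`. -/
def Setup.root [Field F] (S : Setup f F D) (B : Block f F) : D :=
  merkle (fun a b => S.hash (.node a b))
    (fun i => S.hash (.leaf i (S.encode B (Fin.ofNat (2 * f + 1) i)))) 0 (2 * f + 1)

/-- The identifier `H(I)` of a predecessor, and `⊥` for the empty chain. -/
def Setup.ref (S : Setup f F D) (x : Tip D) : Option D := x.map fun I => S.hash (.ident I)

/-- `x` contains the identifier of `y`; then `y` is the predecessor of `x`. -/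
def Setup.Contains (S : Setup f F D) (x y : Tip D) : Prop :=
  ∃ I : IdBlock D, x = some I ∧ I.prev = S.ref y

/-- `x` extends `y`: `y` is reached from `x` by passing to predecessors (possibly zero times). -/
def Setup.Extends (S : Setup f F D) : Tip D → Tip D → Prop := Relation.ReflTransGen S.Contains

/-! ### Messages. Every message is signed by its `signer`. -/

/-- A certificate `C_v(x)`: the votes for `x` in view `v` of the nodes in `signers`. -/
structure Cert (f : ℕ) (D : Type w) where
  view : ℕ
  block : Tip D
  signers : Finset (Node f)

/-- The certificate of the empty chain with which the first view starts. -/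
def Cert.initial : Cert f D := ⟨0, none, ∅⟩

/-- A certificate is valid if it is the initial one or carries votes of `f+1` distinct nodes. -/
def Cert.Valid (C : Cert f D) : Prop := C = Cert.initial ∨ C.signers.card = f + 1

/-- The rank `(v, h)`, ordered lexicographically. -/
def Cert.rank (C : Cert f D) : ℕ ×ₗ ℕ := toLex (C.view, tipHeight C.block)

/-- `⟨proposal, Y, v, C_v(I_{h-1})⟩_L` with the segment `Y = (idx, chunk, block)`. -/
structure Proposal (f : ℕ) (F : Type u) (D : Type w) where
  idx : Node f
  chunk : Chunk F
  block : IdBlock D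
  view : ℕ
  cert : Cert f D

/-- `⟨new-view, v, C⟩_L`. -/
structure NewView (f : ℕ) (D : Type w) where
  view : ℕ
  cert : Cert f D

/-- The messages that only the leader of a view may sign. -/
inductive LeaderMsg (f : ℕ) (F : Type u) (D : Type w) where
  | prop (P : Proposal f F D)
  | newView (N : NewView f D)

/-- The three types of evidence: equivocation, error, silence. -/
inductive Evidence (f : ℕ) (F : Type u) (D : Type w) where
  | equivocation (a b : LeaderMsg f F D)
  | error (ps : List (Proposal f F D))
  | silence (s : Finset (Node f))

/-- Messages; `r` is the signer where it is not the leader of the view. -/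
inductive Msg (f : ℕ) (F : Type u) (D : Type w) where
  | lead (a : LeaderMsg f F D)
  | vote (r : Node f) (x : Tip D) (v : ℕ)
  | blame (r : Node f) (v : ℕ)
  | status (r : Node f) (v : ℕ) (C : Cert f D)
  | quit (r : Node f) (ε : Evidence f F D) (v : ℕ)

/-- A proposal as a message. -/
abbrev Msg.prop (P : Proposal f F D) : Msg f F D := .lead (.prop P)

/-- A new-view message. -/
abbrev Msg.newView (N : NewView f D) : Msg f F D := .lead (.newView N)

def LeaderMsg.view : LeaderMsg f F D → ℕ
  | .prop P => P.view
  | .newView N => N.view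

/-- The identifier block that a proposal or new-view message puts forward. -/
def LeaderMsg.block : LeaderMsg f F D → Tip D
  | .prop P => some P.block
  | .newView N => N.cert.block

def LeaderMsg.cert : LeaderMsg f F D → Cert f D
  | .prop P => P.cert
  | .newView N => N.cert

def Msg.signer : Msg f F D → Node f
  | .lead a => leader f a.view
  | .vote r _ _ => r
  | .blame r _ => r
  | .status r _ _ => r
  | .quit r _ _ => r

/-- The certificates contained in a piece of evidence. -/
def Evidence.certs : Evidence f F D → Set (Cert f D)
  | .equivocation a b => {a.cert, b.cert}
  | .error ps => {C | ∃ P ∈ ps, C = P.cert}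
  | .silence _ => ∅

/-- The certificates contained in a message. -/
def Msg.certs : Msg f F D → Set (Cert f D)
  | .lead a => {a.cert}
  | .status _ _ C => {C}
  | .quit _ ε _ => ε.certs
  | .vote _ _ _ => ∅
  | .blame _ _ => ∅

/-- The signed messages, other than votes in certificates, that evidence about view `v` contains. -/
def Evidence.msgs (v : ℕ) : Evidence f F D → Set (Msg f F D)
  | .equivocation a b => {.lead a, .lead b}
  | .error ps => {m | ∃ P ∈ ps, m = .prop P}
  | .silence s => {m | ∃ r ∈ s, m = .blame r v}

/-- All signed messages of which a message carries the signature: itself, the messages packed as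
evidence, and the votes packed in certificates. -/
def Msg.parts (m : Msg f F D) : Set (Msg f F D) :=
  {m} ∪ {m' | ∃ r ε v, m = .quit r ε v ∧ m' ∈ ε.msgs v} ∪
    {m' | ∃ C ∈ m.certs, ∃ r ∈ C.signers, m' = .vote r C.block C.view}

/-- Legal format. A proposal of view `v` carries a valid certificate of view `v` for the predecessor
of the proposed identifier block; a new-view message carries a valid certificate. -/
def Setup.Legal (S : Setup f F D) : LeaderMsg f F D → Prop
  | .prop P => P.cert.Valid ∧ P.cert.view = P.view ∧ P.block.prev = S.ref P.cert.block ∧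
      P.block.height = tipHeight P.cert.block + 1
  | .newView N => N.cert.Valid

/-- `ps` consists of `f+1` legal proposals of view `v` with distinct segments and the same `I`. -/
def Setup.Segments (S : Setup f F D) (ps : List (Proposal f F D)) (I : IdBlock D) (v : ℕ) : Prop :=
  ps.length = f + 1 ∧ (ps.map Proposal.idx).Nodup ∧
    ∀ P ∈ ps, S.Legal (.prop P) ∧ P.view = v ∧ P.block = I

/-- The chunks in `ps` decode to `B`, and `B` has the Merkle root announced in `I`. -/
def Setup.Decodes [Field F] (S : Setup f F D) (ps : List (Proposal f F D)) (I : IdBlock D)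
    (B : Block f F) : Prop :=
  (∀ P ∈ ps, P.chunk = S.encode B P.idx) ∧ S.root B = I.root

/-- Evidence against the leader of view `v`. Equivocation: two proposals or new-view messages
neither of which extends the other. Error: `f+1` segments with a common identifier block that do not
decode to a block with the announced root. Silence: blames of `f+1` nodes. -/
def Setup.Proves [Field F] (S : Setup f F D) (v : ℕ) : Evidence f F D → Prop
  | .equivocation a b => S.Legal a ∧ S.Legal b ∧ a.view = v ∧ b.view = v ∧
      ¬ S.Extends a.block b.block ∧ ¬ S.Extends b.block a.block
  | .error ps => ∃ I, S.Segments ps I v ∧ ¬ ∃ B, S.Decodes ps I B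
  | .silence s => s.card = f + 1

/-! ### States -/

/-- The local state of a node. -/
structure Local (f : ℕ) (F : Type u) (D : Type w) where
  /-- current view and the time of entering it -/
  view : ℕ
  enter : ℝ
  /-- locked certificate -/
  lock : Cert f D
  /-- messages received so far, together with the own ones -/
  log : Set (Msg f F D)
  /-- messages signed so far -/
  signed : Set (Msg f F D)
  /-- messages forwarded so far -/
  fwd : Set (Msg f F D)
  /-- running commit-timers of the current view, with the times at which they reach zero -/
  timers : Set (Tip D × ℝ)
  /-- directly committed identifier blocks -/
  direct : Set (Tip D)
  /-- complete blocks obtained by successful decoding, with their identifier blocks -/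
  store : Set (IdBlock D × Block f F)

/-- The global state: the time, the local states, and all messages sent by honest nodes so far,
as triples of receiver, message, sending time. -/
structure Config (f : ℕ) (F : Type u) (D : Type w) where
  clock : ℝ
  node : Node f → Local f F D
  net : Set (Node f × Msg f F D × ℝ)

/-- At time `0` all nodes are in view `0` and nothing has happened. -/
def Config.init : Config f F D where
  clock := 0
  node _ := ⟨0, 0, Cert.initial, ∅, ∅, ∅, ∅, ∅, ∅⟩
  net := ∅

def Config.update (c : Config f F D) (r : Node f) (g : Local f F D → Local f F D) :
    Config f F D :=
  { c with node := Function.update c.node r (g (c.node r)) }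

/-- Send `m` to `q` now. -/
def Config.send (c : Config f F D) (q : Node f) (m : Msg f F D) : Config f F D :=
  { c with net := insert (q, m, c.clock) c.net }

/-- Send `m` to all nodes now. -/
def Config.broadcast (c : Config f F D) (m : Msg f F D) : Config f F D :=
  { c with net := c.net ∪ {x | x.2.1 = m ∧ x.2.2 = c.clock} }

/-- Sign a message and keep a copy. -/
def Local.sign (s : Local f F D) (m : Msg f F D) : Local f F D :=
  { s with signed := insert m s.signed, log := insert m s.log }

/-- The valid certificates known from a log: the initial one, those contained in a message of the
log, and those that can be generated from votes in the log. -/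
def Known (log : Set (Msg f F D)) (C : Cert f D) : Prop :=
  C.Valid ∧ (C = Cert.initial ∨ (∃ m ∈ log, C ∈ m.certs) ∨
    ∀ r ∈ C.signers, Msg.vote r C.block C.view ∈ log)

/-- `C` is a highest ranked certificate known from a log. -/
def Highest (log : Set (Msg f F D)) (C : Cert f D) : Prop :=
  Known log C ∧ ∀ C', Known log C' → C'.rank ≤ C.rank

/-- Own evidence against the leader of view `v`, packed from messages of the log. -/
def Setup.Found [Field F] (S : Setup f F D) (log : Set (Msg f F D)) (v : ℕ)
    (ε : Evidence f F D) : Prop :=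
  S.Proves v ε ∧ ε.msgs v ⊆ log

/-- Node `r` has no reason to quit its current view: it has no evidence of its own and no quit-view
message with verified evidence. -/
def Setup.Active [Field F] (S : Setup f F D) (c : Config f F D) (r : Node f) : Prop :=
  (¬ ∃ ε, S.Found (c.node r).log (c.node r).view ε) ∧
    ¬ ∃ q ε, Msg.quit q ε (c.node r).view ∈ (c.node r).log ∧ S.Proves (c.node r).view ε

/-- Status step: having quit its view, node `r` locks `C`, sends `C` to the leader of the next view
and enters the next view. -/
def Config.nextView (c : Config f F D) (r : Node f) (C : Cert f D) : Config f F D :=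
  let v := (c.node r).view + 1
  (c.update r fun s => { s.sign (.status r v C) with
    view := v, enter := c.clock, lock := C, timers := ∅ }).send (leader f v) (.status r v C)

/-- `React S c r c'`: in state `c` node `r` performs one of the protocol steps that it has to
perform without delay, which leads to `c'`. -/
inductive React [Field F] (S : Setup f F D) (c : Config f F D) (r : Node f) :
    Config f F D → Prop
  /-- Re-propose and pre-commit: the first proposal of a height in the view is forwarded, and
  the commit-timer for its predecessor is set to `2Δ`. -/
  | repropose (P : Proposal f F D) :
      S.Active c r → Msg.prop P ∈ (c.node r).log → S.Legal (.prop P) →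
      P.view = (c.node r).view →
      (∀ P', Msg.prop P' ∈ (c.node r).fwd → P'.view = P.view →
        P'.block.height ≠ P.block.height) →
      React S c r ((c.update r fun s => { s with
        fwd := insert (.prop P) s.fwd
        timers := insert (P.cert.block, c.clock + 2 * S.Δ) s.timers }).broadcast (.prop P))
  /-- Re-propose: the first proposal tailored for `r` is forwarded, too. -/
  | reproposeOwn (P : Proposal f F D) :
      S.Active c r → Msg.prop P ∈ (c.node r).log → S.Legal (.prop P) →
      P.view = (c.node r).view → P.idx = r →
      (∃ P', Msg.prop P' ∈ (c.node r).fwd ∧ P'.view = P.view ∧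
        P'.block.height = P.block.height) →
      (∀ P', Msg.prop P' ∈ (c.node r).fwd → P'.view = P.view →
        P'.block.height = P.block.height → P'.idx ≠ r) →
      React S c r ((c.update r fun s => { s with
        fwd := insert (.prop P) s.fwd }).broadcast (.prop P))
  /-- Vote, after re-proposing and on successful decoding. -/
  | vote (ps : List (Proposal f F D)) (I : IdBlock D) (B : Block f F) :
      S.Active c r → (∀ P ∈ ps, Msg.prop P ∈ (c.node r).log) →
      S.Segments ps I (c.node r).view → S.Decodes ps I B →
      (∃ P', Msg.prop P' ∈ (c.node r).fwd ∧ P'.view = (c.node r).view ∧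
        P'.block.height = I.height) →
      ¬ (Msg.vote r (some I) (c.node r).view ∈ (c.node r).signed ∧
        (I, B) ∈ (c.node r).store) →
      React S c r ((c.update r fun s => { s.sign (.vote r (some I) s.view) with
        store := insert (I, B) s.store }).broadcast (.vote r (some I) (c.node r).view))
  /-- Commit, when a commit-timer reaches zero and `r` is still in the view. Messages that are due
  by now are taken into account first. -/
  | commit (x : Tip D) :
      S.Active c r → (x, c.clock) ∈ (c.node r).timers →
      (∀ m t, (r, m, t) ∈ c.net → t + S.Δ ≤ c.clock → m ∈ (c.node r).log) →
      React S c r (c.update r fun s => { s with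
        timers := s.timers \ {(x, c.clock)}
        direct := insert x s.direct })
  /-- Quit-view on own evidence, followed by the status step. -/
  | quit (ε : Evidence f F D) (C : Cert f D) :
      S.Found (c.node r).log (c.node r).view ε → Highest (c.node r).log C →
      React S c r (((c.update r fun s => s.sign (.quit r ε s.view)).broadcast
        (.quit r ε (c.node r).view)).nextView r C)
  /-- Quit-view on a received quit-view message, which is forwarded, followed by the status
  step. -/
  | quitForward (q : Node f) (ε : Evidence f F D) (C : Cert f D) :
      Msg.quit q ε (c.node r).view ∈ (c.node r).log → S.Proves (c.node r).view ε →
      Highest (c.node r).log C →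
      React S c r (((c.update r fun s => { s with
        fwd := insert (.quit q ε s.view) s.fwd }).broadcast
        (.quit q ε (c.node r).view)).nextView r C)
  /-- View-start: a new-view message whose certificate ranks no lower than the lock is forwarded,
  and `r` votes for its block. -/
  | viewStart (N : NewView f D) :
      S.Active c r → Msg.newView N ∈ (c.node r).log → S.Legal (.newView N : LeaderMsg f F D) →
      N.view = (c.node r).view → (c.node r).lock.rank ≤ N.cert.rank →
      Msg.newView N ∉ (c.node r).fwd →
      React S c r (((c.update r fun s => { s.sign (.vote r N.cert.block N.view) with
        fwd := insert (.newView N) s.fwd }).broadcast (.newView N)).broadcast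
        (.vote r N.cert.block N.view))

/-- The proposal for node `i` of the block `B` on top of the certificate `C` of view `v`. -/
def Setup.mkProposal [Field F] (S : Setup f F D) (B : Block f F) (v : ℕ) (C : Cert f D)
    (i : Node f) : Proposal f F D where
  idx := i
  chunk := S.encode B i
  block := ⟨tipHeight C.block + 1, S.root B, S.ref C.block⟩
  view := v
  cert := C

/-- Protocol steps that a node takes on its own initiative, when they are permitted. Nothing is
assumed about how soon they are taken. -/
inductive Initiate [Field F] (S : Setup f F D) (c : Config f F D) (r : Node f) :
    Config f F D → Prop
  /-- Propose: the leader, knowing `C_v(I_{h-1})`, picks a block for height `h` and sends each node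
  its proposal; one block per height and view. -/
  | propose (C : Cert f D) (B : Block f F) :
      S.Active c r → r = leader f (c.node r).view → Known (c.node r).log C →
      C.view = (c.node r).view →
      (∀ P, Msg.prop P ∈ (c.node r).signed → P.view = (c.node r).view →
        P.block.height ≠ tipHeight C.block + 1) →
      Initiate S c r { c with
        node := Function.update c.node r { c.node r with
          signed := (c.node r).signed ∪
            {m | ∃ i, m = .prop (S.mkProposal B (c.node r).view C i)}
          log := insert (.prop (S.mkProposal B (c.node r).view C r)) (c.node r).log }
        net := c.net ∪
          {x | x.2.1 = .prop (S.mkProposal B (c.node r).view C x.1) ∧ x.2.2 = c.clock} }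
  /-- New-view: having waited for `2Δ` in its view, a new leader broadcasts a highest certificate
  known to it; once per view. -/
  | newView (C : Cert f D) :
      S.Active c r → r = leader f (c.node r).view → 0 < (c.node r).view →
      (c.node r).enter + 2 * S.Δ ≤ c.clock → Highest (c.node r).log C →
      (∀ N, Msg.newView N ∈ (c.node r).signed → N.view ≠ (c.node r).view) →
      Initiate S c r ((c.update r fun s => s.sign (.newView ⟨s.view, C⟩)).broadcast
        (.newView ⟨(c.node r).view, C⟩))
  /-- Blame: `r` has not voted `p` times within `(3p+4)Δ` in its view. -/
  | blame (p : ℕ) :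
      S.Active c r → (c.node r).enter + (3 * p + 4) * S.Δ ≤ c.clock →
      {x | Msg.vote r x (c.node r).view ∈ (c.node r).signed}.ncard < p →
      Msg.blame r (c.node r).view ∉ (c.node r).signed →
      Initiate S c r ((c.update r fun s => s.sign (.blame r s.view)).broadcast
        (.blame r (c.node r).view))

/-- Signatures cannot be forged: every signature of an honest node carried by `m` was made by that
node. Apart from this, Byzantine nodes may produce any message. -/
def Setup.Authentic (S : Setup f F D) (c : Config f F D) (m : Msg f F D) : Prop :=
  ∀ m' ∈ m.parts, m'.signer ∈ S.honest → m' ∈ (c.node m'.signer).signed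

/-- One step of an execution under standard synchrony. -/
inductive Step [Field F] (S : Setup f F D) (c : Config f F D) : Config f F D → Prop
  /-- An honest node receives a message, from an honest or a Byzantine node, at any moment that the
  adversary chooses. -/
  | deliver (q : Node f) (m : Msg f F D) : q ∈ S.honest → S.Authentic c m →
      Step S c (c.update q fun s => { s with log := insert m s.log })
  | react (r : Node f) (c' : Config f F D) : r ∈ S.honest → React S c r c' → Step S c c'
  | initiate (r : Node f) (c' : Config f F D) : r ∈ S.honest → Initiate S c r c' → Step S c c'
  /-- Time passes until `t`, provided that no honest node has a step to perform without delay,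
  no commit-timer is skipped, and every message sent from an honest node to an honest node more than
  `Δ` before `t` has been received. -/
  | tick (t : ℝ) : c.clock ≤ t →
      (∀ r ∈ S.honest, ∀ c', ¬ React S c r c') →
      (∀ r ∈ S.honest, ∀ x T, (x, T) ∈ (c.node r).timers → t ≤ T) →
      (∀ q ∈ S.honest, ∀ m s, (q, m, s) ∈ c.net → s + S.Δ < t → m ∈ (c.node q).log) →
      Step S c { c with clock := t }

/-- The states that executions can reach. -/
def Setup.Reachable [Field F] (S : Setup f F D) (c : Config f F D) : Prop :=
  Relation.ReflTransGen (Step S) Config.init c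

/-- Node `r` has committed `I`, directly, or indirectly by committing an extension of `I`. -/
def Setup.Committed (S : Setup f F D) (c : Config f F D) (r : Node f) (I : IdBlock D) : Prop :=
  ∃ x ∈ (c.node r).direct, S.Extends x (some I)

/-- Node `r` holds the complete block `B` behind `I`. -/
def Setup.Holds [Field F] (S : Setup f F D) (c : Config f F D) (r : Node f) (I : IdBlock D)
    (B : Block f F) : Prop :=
  (I, B) ∈ (c.node r).store ∧ S.root B = I.root

end Hamster

namespace Hamster

universe u w

variable {f : ℕ} {F : Type u} {D : Type w}

/-! ### Chains of identifier blocks -/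

/-! Fix a direct commit by `r`, triggered by a proposal `P` that carries the certificate of the
committed block. If `r` forwards `P` at time `t`, its timer ends at `t + 2Δ`. The first `Δ` brings
`P` to every honest node; the second brings back to `r` anything that speaks against the commit.

An honest node that left the view of `P` by time `t + Δ` would have sent evidence reaching `r`
before the timer ends. So honest nodes leave later, when they know `P`, and lock a certificate of
rank at least that of `P.cert`. Likewise, an honest vote in the view of `P` is for a block
comparable with `P.block`: either the voter had forwarded a leader message for that block early
enough for `r` to see it, or it voted late enough to know `P` itself. Without evidence, two legal
leader messages of one view are comparable.

In later views every honest vote extends the committed block, by induction on the execution. A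
certificate contains an honest vote, and a new view can only start from a certificate ranking at
least as high as the honest locks. `Setup.Guard` collects these facts and persists, because all
honest nodes know `P` from then on. Two guarded certificates therefore have comparable blocks
(`Setup.Guard.comparable_of_le`), and comparable chains of equal height coincide.

Availability is a separate induction (`Setup.Reachable.backed_of_vote`): each honest vote is for a
block whose whole chain is stored, blockwise, at honest nodes. -/

/-- A tip whose predecessors end in `⊥` and whose recorded heights are correct. -/
inductive Setup.Chain (S : Setup f F D) : Tip D → Prop
  | nil : Setup.Chain S none
  | cons (I : IdBlock D) (y : Tip D) : I.prev = S.ref y → I.height = tipHeight y + 1 →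
      Setup.Chain S y → Setup.Chain S (some I)

/-- One of two tips extends the other. -/
def Setup.Comparable (S : Setup f F D) (x y : Tip D) : Prop := S.Extends x y ∨ S.Extends y x

theorem Setup.ref_injective {S : Setup f F D} (hS : Function.Injective S.hash) :
    Function.Injective S.ref :=
  Option.map_injective fun _ _ h => HashInput.ident.inj (hS h)

theorem Setup.contains_rightUnique {S : Setup f F D} (hS : Function.Injective S.hash) :
    Relator.RightUnique S.Contains := by
  rintro x y z ⟨I, rfl, hy⟩ ⟨J, hJ, hz⟩
  cases hJ
  exact S.ref_injective hS (hy.symm.trans hz)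

theorem Setup.Chain.extends_none {S : Setup f F D} {x : Tip D} (hx : S.Chain x) :
    S.Extends x none := by
  induction hx with
  | nil => exact .refl
  | cons I y h _ _ ih => exact .head ⟨I, rfl, h⟩ ih

theorem Setup.Chain.eq_none {S : Setup f F D} {x : Tip D} (hx : S.Chain x)
    (h : tipHeight x = 0) : x = none := by
  cases hx with
  | nil => rfl
  | cons I y _ h' _ => simp [tipHeight] at h h'; omega

/-- Collision-freeness makes the predecessor unique, so a walk to predecessors stays on the chain
and lowers the recorded height by one at each step. -/
theorem Setup.Chain.of_extends {S : Setup f F D} (hS : Function.Injective S.hash) {x y : Tip D}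
    (hx : S.Chain x) (hxy : S.Extends x y) :
    S.Chain y ∧ (x = y ∨ tipHeight y < tipHeight x) := by
  induction hxy using Relation.ReflTransGen.head_induction_on with
  | refl => exact ⟨hx, .inl rfl⟩
  | head h _ ih =>
    obtain ⟨I, rfl, hp⟩ := h
    cases hx with
    | cons _ z hz hh hc =>
      obtain rfl := S.ref_injective hS (hz.symm.trans hp)
      obtain ⟨h1, h2⟩ := ih hc
      refine ⟨h1, .inr ?_⟩
      have : tipHeight (some I) = I.height := rfl
      rcases h2 with rfl | h2 <;> omega

theorem Setup.Comparable.symm {S : Setup f F D} {x y : Tip D} (h : S.Comparable x y) :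
    S.Comparable y x := Or.symm h

theorem Setup.Comparable.extends_of_le {S : Setup f F D} (hS : Function.Injective S.hash)
    {x y : Tip D} (h : S.Comparable x y) (hy : S.Chain y)
    (hle : tipHeight y ≤ tipHeight x) : S.Extends x y := by
  rcases h with h | h
  · exact h
  · rcases (hy.of_extends hS h).2 with rfl | h'
    · exact .refl
    · omega

theorem Setup.Comparable.eq_of_height {S : Setup f F D} (hS : Function.Injective S.hash)
    {x y : Tip D} (h : S.Comparable x y) (hx : S.Chain x) (hy : S.Chain y)
    (he : tipHeight x = tipHeight y) : x = y := by
  rcases (hx.of_extends hS (h.extends_of_le hS hy he.ge)).2 with h | h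
  · exact h
  · omega

/-- If `y` extends `x` properly, its first step must go to `z`, the only predecessor of `y`; hence
`z` still extends `x`. -/
theorem Setup.Comparable.of_contains {S : Setup f F D} (hS : Function.Injective S.hash)
    {x y z : Tip D} (h : S.Comparable x y) (hyz : S.Contains y z) : S.Comparable x z := by
  rcases h with h | h
  · exact .inl (h.tail hyz)
  · rcases Relation.ReflTransGen.cases_head h with rfl | ⟨w, hw, hwx⟩
    · exact .inl (.single hyz)
    · obtain rfl := S.contains_rightUnique hS hw hyz
      exact .inr hwx

theorem Setup.Comparable.of_extends {S : Setup f F D} (hS : Function.Injective S.hash)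
    {x y z : Tip D} (h : S.Comparable x y) (hyz : S.Extends y z) : S.Comparable x z := by
  induction hyz with
  | refl => exact h
  | tail _ hc ih => exact ih.of_contains hS hc

theorem Setup.Legal.contains {S : Setup f F D} {P : Proposal f F D} (h : S.Legal (.prop P)) :
    S.Contains (some P.block) P.cert.block := ⟨P.block, rfl, h.2.2.1⟩

/-! ### Effects of a step -/

/-- What every step preserves: nothing that was recorded is forgotten, and new messages are sent
at the current time. -/
structure Mono (c c' : Config f F D) : Prop where
  clock : c.clock ≤ c'.clock
  net : c.net ⊆ c'.net
  net_new : ∀ x ∈ c'.net, x ∈ c.net ∨ c.clock ≤ x.2.2 ∧ x.2.2 ≤ c'.clock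
  log : ∀ q, (c.node q).log ⊆ (c'.node q).log
  signed : ∀ q, (c.node q).signed ⊆ (c'.node q).signed
  store : ∀ q, (c.node q).store ⊆ (c'.node q).store

theorem Mono.refl (c : Config f F D) : Mono c c :=
  ⟨le_rfl, subset_rfl, fun _ h => .inl h, fun _ => subset_rfl, fun _ => subset_rfl,
    fun _ => subset_rfl⟩

theorem Mono.trans {a b c : Config f F D} (h : Mono a b) (h' : Mono b c) : Mono a c where
  clock := h.clock.trans h'.clock
  net := h.net.trans h'.net
  net_new x hx := by
    rcases h'.net_new x hx with h1 | ⟨h1, h2⟩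
    · rcases h.net_new x h1 with h3 | ⟨h3, h4⟩
      · exact .inl h3
      · exact .inr ⟨h3, h4.trans h'.clock⟩
    · exact .inr ⟨h.clock.trans h1, h2⟩
  log q := (h.log q).trans (h'.log q)
  signed q := (h.signed q).trans (h'.signed q)
  store q := (h.store q).trans (h'.store q)

/-! ### Certificates, evidence and honest support -/

theorem Evidence.exists_msg_of_mem_certs {ε : Evidence f F D} {C : Cert f D} (hC : C ∈ ε.certs)
    (v : ℕ) : ∃ m ∈ ε.msgs v, C ∈ m.certs := by
  cases ε with
  | equivocation a b =>
    rcases hC with rfl | rfl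
    · exact ⟨.lead a, .inl rfl, rfl⟩
    · exact ⟨.lead b, .inr rfl, rfl⟩
  | error ps =>
    obtain ⟨P, hP, rfl⟩ := hC
    exact ⟨.prop P, ⟨P, hP, rfl⟩, rfl⟩
  | silence s => exact hC.elim

/-- The votes of honest nodes in `C` were signed. -/
def Setup.Supported (S : Setup f F D) (c : Config f F D) (C : Cert f D) : Prop :=
  ∀ r ∈ C.signers, r ∈ S.honest → Msg.vote r C.block C.view ∈ (c.node r).signed

/-- At most `f` nodes are Byzantine, so `f + 1` signers include an honest one. The initial
certificate is the exception, having no signers. -/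
theorem Cert.Valid.exists_honest {S : Setup f F D} (hbyz : S.honestᶜ.card ≤ f) {C : Cert f D}
    (hC : C.Valid) : C = Cert.initial ∨ ∃ r ∈ C.signers, r ∈ S.honest := by
  refine hC.imp_right fun h => ?_
  by_contra! hn
  have : C.signers ⊆ S.honestᶜ := fun r hr => Finset.mem_compl.2 (hn r hr)
  have := Finset.card_le_card this
  omega

theorem Setup.Supported.mono {S : Setup f F D} {c c' : Config f F D} (h : Mono c c')
    {C : Cert f D} (hC : S.Supported c C) : S.Supported c' C :=
  fun r hr hr' => h.signed r (hC r hr hr')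

theorem Setup.Segments.exists_mem {S : Setup f F D} {ps : List (Proposal f F D)} {I : IdBlock D}
    {v : ℕ} (h : S.Segments ps I v) : ∃ P ∈ ps, S.Legal (.prop P) ∧ P.view = v ∧ P.block = I := by
  obtain ⟨P, hP⟩ := List.exists_mem_of_length_pos (l := ps) (by rw [h.1]; omega)
  exact ⟨P, hP, h.2.2 P hP⟩

variable [Field F]

theorem Step.mono {S : Setup f F D} {c c' : Config f F D} (h : Step S c c') : Mono c c' := by
  cases h with
  | tick t ht => exact { Mono.refl c with clock := ht, net_new := fun _ h => .inl h }
  | deliver r m =>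
    refine ⟨le_rfl, subset_rfl, fun _ h => .inl h, fun q => ?_, fun q => ?_, fun q => ?_⟩ <;>
    by_cases hq : q = r <;> simp [Config.update, hq]
  | react r _ _ h =>
    cases h <;> (
      refine ⟨le_rfl, fun x hx => ?_, fun x hx => ?_, fun q => ?_, fun q => ?_, fun q => ?_⟩
      · simp [Config.nextView, Config.update, Config.send, Config.broadcast, hx]
      · simp [Config.nextView, Config.update, Config.send, Config.broadcast] at hx ⊢
        grind
      all_goals by_cases hq : q = r <;>
        simp [Config.nextView, Config.update, Config.send, Config.broadcast, Local.sign, hq,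
          Set.subset_def] <;> tauto)
  | initiate r _ _ h =>
    cases h <;> (
      refine ⟨le_rfl, fun x hx => ?_, fun x hx => ?_, fun q => ?_, fun q => ?_, fun q => ?_⟩
      · simp [Config.update, Config.broadcast, hx]
      · simp [Config.update, Config.broadcast] at hx ⊢
        grind
      all_goals by_cases hq : q = r <;>
        simp [Config.update, Config.broadcast, Local.sign, hq,
          Set.subset_def] <;> tauto)

theorem mono_of_steps {S : Setup f F D} {c c' : Config f F D}
    (h : Relation.ReflTransGen (Step S) c c') : Mono c c' := by
  induction h with
  | refl => exact .refl c
  | tail _ h ih => exact ih.trans h.mono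

/-- The origin of a new vote. -/
theorem Step.vote_cases {S : Setup f F D} {c c' : Config f F D} (h : Step S c c') {q : Node f}
    {x : Tip D} {v : ℕ} (hv : Msg.vote q x v ∈ (c'.node q).signed) :
    Msg.vote q x v ∈ (c.node q).signed ∨
    q ∈ S.honest ∧ S.Active c q ∧ v = (c.node q).view ∧ c'.clock = c.clock ∧
    ((∃ ps I B, x = some I ∧ (∀ P ∈ ps, Msg.prop P ∈ (c.node q).log) ∧
        S.Segments ps I (c.node q).view ∧ S.Decodes ps I B ∧
        (∃ P', Msg.prop P' ∈ (c.node q).fwd ∧ P'.view = (c.node q).view ∧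
          P'.block.height = I.height) ∧ (I, B) ∈ (c'.node q).store) ∨
      ∃ N : NewView f D, x = N.cert.block ∧ Msg.newView N ∈ (c.node q).log ∧
        S.Legal (.newView N : LeaderMsg f F D) ∧ N.view = (c.node q).view ∧
        (c.node q).lock.rank ≤ N.cert.rank ∧ ∀ p, (p, Msg.newView N, c.clock) ∈ c'.net) := by
  cases h with
  | tick t ht => exact .inl hv
  | deliver r m =>
    by_cases hq : q = r
    · subst hq; simp [Config.update] at hv; exact .inl hv
    · simp [Config.update, hq] at hv; exact .inl hv
  | react r _ hr h =>
    by_cases hq : q = r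
    · subst hq
      cases h with
      | vote ps I B h1 h2 h3 h4 h5 h6 =>
        simp [Config.update, Config.broadcast, Local.sign] at hv
        rcases hv with ⟨rfl, rfl⟩ | hv
        · exact .inr ⟨hr, h1, rfl, rfl, .inl ⟨ps, I, B, rfl, h2, h3, h4, h5,
            by simp [Config.update, Config.broadcast, Local.sign]⟩⟩
        · exact .inl hv
      | viewStart N h1 h2 h3 h4 h5 h6 =>
        simp [Config.update, Config.broadcast, Local.sign] at hv
        rcases hv with ⟨rfl, rfl⟩ | hv
        · exact .inr ⟨hr, h1, h4, rfl, .inr ⟨N, rfl, h2, h3, h4, h5,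
            by simp [Config.update, Config.broadcast, Local.sign]⟩⟩
        · exact .inl hv
      | _ =>
        simp [Config.nextView, Config.update, Config.send, Config.broadcast, Local.sign] at hv
        exact .inl hv
    · left
      cases h <;>
      simpa [Config.nextView, Config.update, Config.send, Config.broadcast, Local.sign, hq] using hv
  | initiate r _ hr h =>
    left
    by_cases hq : q = r
    · subst hq
      cases h <;> simpa [Config.update, Config.broadcast, Local.sign] using hv
    · cases h <;> simpa [Config.update, Config.broadcast, Local.sign, hq] using hv

/-- The reason for a change of the view. -/
theorem Step.view_cases {S : Setup f F D} {c c' : Config f F D} (h : Step S c c') (q : Node f) :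
    (c'.node q).view = (c.node q).view ∧ (c'.node q).lock = (c.node q).lock ∨
    q ∈ S.honest ∧ (c'.node q).view = (c.node q).view + 1 ∧
      Highest (c.node q).log (c'.node q).lock ∧
      ∃ p ε, S.Proves (c.node q).view ε ∧
        ∀ i, (i, Msg.quit p ε (c.node q).view, c.clock) ∈ c'.net := by
  cases h with
  | tick t ht => exact .inl ⟨rfl, rfl⟩
  | deliver r m => by_cases hq : q = r <;> simp [Config.update, hq]
  | react r _ hr h =>
    by_cases hq : q = r
    · subst hq
      cases h with
      | quit ε C h1 h2 =>
        refine .inr ⟨hr, ?_, ?_, q, ε, h1.1, ?_⟩ <;>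
        simp [Config.nextView, Config.update, Config.send, Config.broadcast, Local.sign, h2]
      | quitForward p ε C h1 h2 h3 =>
        refine .inr ⟨hr, ?_, ?_, p, ε, h2, ?_⟩ <;>
        simp [Config.nextView, Config.update, Config.send, Config.broadcast, Local.sign, h3]
      | _ => simp [Config.update, Config.broadcast, Local.sign]
    · left
      cases h <;>
      simp [Config.nextView, Config.update, Config.send, Config.broadcast, Local.sign, hq]
  | initiate r _ hr h =>
    left
    by_cases hq : q = r
    · subst hq
      cases h <;> simp [Config.update, Config.broadcast, Local.sign]
    · cases h <;> simp [Config.update, Config.broadcast, Local.sign, hq]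

/-- The origin of a forwarded proposal. -/
theorem Step.fwd_cases {S : Setup f F D} {c c' : Config f F D} (h : Step S c c') {q : Node f}
    {P : Proposal f F D} (hP : Msg.prop P ∈ (c'.node q).fwd) :
    Msg.prop P ∈ (c.node q).fwd ∨
    S.Legal (.prop P) ∧ Msg.prop P ∈ (c.node q).log ∧
      ∀ i, (i, Msg.prop P, c.clock) ∈ c'.net := by
  cases h with
  | tick t ht => exact .inl hP
  | deliver r m =>
    by_cases hq : q = r
    · subst hq; simp [Config.update] at hP; exact .inl hP
    · simp [Config.update, hq] at hP; exact .inl hP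
  | react r _ hr h =>
    by_cases hq : q = r
    · subst hq
      cases h with
      | repropose P' h1 h2 h3 =>
        simp [Config.update, Config.broadcast] at hP
        rcases hP with rfl | hP
        · exact .inr ⟨h3, h2, by simp [Config.update, Config.broadcast]⟩
        · exact .inl hP
      | reproposeOwn P' h1 h2 h3 =>
        simp [Config.update, Config.broadcast] at hP
        rcases hP with rfl | hP
        · exact .inr ⟨h3, h2, by simp [Config.update, Config.broadcast]⟩
        · exact .inl hP
      | _ =>
        simp [Config.nextView, Config.update, Config.send, Config.broadcast, Local.sign] at hP
        exact .inl hP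
    · left
      cases h <;>
      simpa [Config.nextView, Config.update, Config.send, Config.broadcast, Local.sign, hq] using hP
  | initiate r _ hr h =>
    left
    by_cases hq : q = r
    · subst hq
      cases h <;> simpa [Config.update, Config.broadcast, Local.sign] using hP
    · cases h <;> simpa [Config.update, Config.broadcast, Local.sign, hq] using hP

/-- The origin of a commit-timer. -/
theorem Step.timer_cases {S : Setup f F D} {c c' : Config f F D} (h : Step S c c') {q : Node f}
    {x : Tip D} {T : ℝ} (hT : (x, T) ∈ (c'.node q).timers) :
    (x, T) ∈ (c.node q).timers ∧ (c'.node q).view = (c.node q).view ∨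
    ∃ P, S.Legal (.prop P) ∧ P.view = (c'.node q).view ∧ Msg.prop P ∈ (c.node q).log ∧
      P.cert.block = x ∧ T = c.clock + 2 * S.Δ ∧ ∀ i, (i, Msg.prop P, c.clock) ∈ c'.net := by
  cases h with
  | tick t ht => exact .inl ⟨hT, rfl⟩
  | deliver r m =>
    by_cases hq : q = r
    · subst hq; simp [Config.update] at hT ⊢; exact .inl hT
    · simp [Config.update, hq] at hT ⊢; exact .inl hT
  | react r _ hr h =>
    by_cases hq : q = r
    · subst hq
      cases h with
      | repropose P h1 h2 h3 h4 =>
        simp [Config.update, Config.broadcast] at hT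
        rcases hT with ⟨rfl, rfl⟩ | hT
        · refine .inr ⟨P, h3, ?_, h2, rfl, rfl, ?_⟩ <;>
          simp [Config.update, Config.broadcast, h4]
        · exact .inl ⟨hT, by simp [Config.update, Config.broadcast]⟩
      | commit y =>
        simp [Config.update] at hT ⊢
        exact .inl hT.1
      -- Leaving a view empties the timers, so a running timer always belongs to the current view.
      | quit => simp [Config.nextView, Config.update, Config.send, Config.broadcast] at hT
      | quitForward => simp [Config.nextView, Config.update, Config.send, Config.broadcast] at hT
      | _ =>
        simp [Config.update, Config.broadcast, Local.sign] at hT ⊢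
        exact .inl hT
    · left
      cases h <;>
      simpa [Config.nextView, Config.update, Config.send, Config.broadcast, Local.sign, hq] using hT
  | initiate r _ hr h =>
    left
    by_cases hq : q = r
    · subst hq
      cases h <;> simpa [Config.update, Config.broadcast, Local.sign] using hT
    · cases h <;> simpa [Config.update, Config.broadcast, Local.sign, hq] using hT

/-- The origin of a direct commit. -/
theorem Step.direct_cases {S : Setup f F D} {c c' : Config f F D} (h : Step S c c') {q : Node f}
    {x : Tip D} (hx : x ∈ (c'.node q).direct) :
    x ∈ (c.node q).direct ∨
    q ∈ S.honest ∧ S.Active c q ∧ (x, c.clock) ∈ (c.node q).timers ∧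
      ∀ m t, (q, m, t) ∈ c.net → t + S.Δ ≤ c.clock → m ∈ (c.node q).log := by
  cases h with
  | tick t ht => exact .inl hx
  | deliver r m =>
    by_cases hq : q = r
    · subst hq; simp [Config.update] at hx; exact .inl hx
    · simp [Config.update, hq] at hx; exact .inl hx
  | react r _ hr h =>
    by_cases hq : q = r
    · subst hq
      cases h with
      | commit y h1 h2 h3 =>
        simp [Config.update] at hx
        rcases hx with rfl | hx
        · exact .inr ⟨hr, h1, h2, h3⟩
        · exact .inl hx
      | _ =>
        simp [Config.nextView, Config.update, Config.send, Config.broadcast, Local.sign] at hx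
        exact .inl hx
    · left
      cases h <;>
      simpa [Config.nextView, Config.update, Config.send, Config.broadcast, Local.sign, hq] using hx
  | initiate r _ hr h =>
    left
    by_cases hq : q = r
    · subst hq
      cases h <;> simpa [Config.update, Config.broadcast, Local.sign] using hx
    · cases h <;> simpa [Config.update, Config.broadcast, Local.sign, hq] using hx

/-- The origin of a message that a node knows. -/
theorem Step.log_cases {S : Setup f F D} {c c' : Config f F D} (h : Step S c c') {q : Node f}
    {m : Msg f F D} (hm : m ∈ (c'.node q).log) :
    m ∈ (c.node q).log ∨ S.Authentic c m ∨
    (m ∈ (c'.node q).signed ∧ m.signer = q ∧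
      ∀ C ∈ m.certs, Known (c.node q).log C ∨ ∃ m' ∈ (c.node q).log, C ∈ m'.certs) := by
  cases h with
  | tick t ht => exact .inl hm
  | deliver r m' _ ha =>
    by_cases hq : q = r
    · subst hq
      simp [Config.update] at hm
      rcases hm with rfl | hm
      · exact .inr (.inl ha)
      · exact .inl hm
    · simp [Config.update, hq] at hm; exact .inl hm
  | react r _ hr h =>
    by_cases hq : q = r
    · subst hq
      cases h with
      | vote ps I B =>
        simp [Config.update, Config.broadcast, Local.sign] at hm
        rcases hm with rfl | hm
        · refine .inr (.inr ⟨?_, rfl, fun C hC => hC.elim⟩)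
          simp [Config.update, Config.broadcast, Local.sign]
        · exact .inl hm
      | viewStart N =>
        simp [Config.update, Config.broadcast, Local.sign] at hm
        rcases hm with rfl | hm
        · refine .inr (.inr ⟨?_, rfl, fun C hC => hC.elim⟩)
          simp [Config.update, Config.broadcast, Local.sign]
        · exact .inl hm
      | quit ε C h1 h2 =>
        simp [Config.nextView, Config.update, Config.send, Config.broadcast, Local.sign] at hm
        rcases hm with rfl | rfl | hm
        · refine .inr (.inr ⟨?_, rfl, fun C hC => ?_⟩)
          · simp [Config.nextView, Config.update, Config.send, Config.broadcast, Local.sign]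
          · obtain rfl : C = _ := hC
            exact .inl h2.1
        · refine .inr (.inr ⟨?_, rfl, fun C hC => ?_⟩)
          · simp [Config.nextView, Config.update, Config.send, Config.broadcast, Local.sign]
          · obtain ⟨m', hm', h3⟩ := Evidence.exists_msg_of_mem_certs hC (c.node q).view
            exact .inr ⟨m', h1.2 hm', h3⟩
        · exact .inl hm
      | quitForward p ε C h1 h2 h3 =>
        simp [Config.nextView, Config.update, Config.send, Config.broadcast, Local.sign] at hm
        rcases hm with rfl | hm
        · refine .inr (.inr ⟨?_, rfl, fun C hC => ?_⟩)
          · simp [Config.nextView, Config.update, Config.send, Config.broadcast, Local.sign]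
          · obtain rfl : C = _ := hC
            exact .inl h3.1
        · exact .inl hm
      | _ =>
        simp [Config.update, Config.broadcast] at hm
        exact .inl hm
    · left
      cases h <;>
      simpa [Config.nextView, Config.update, Config.send, Config.broadcast, Local.sign, hq] using hm
  | initiate r _ hr h =>
    by_cases hq : q = r
    · subst hq
      cases h with
      | propose C B h1 h2 h3 =>
        simp at hm
        rcases hm with rfl | hm
        · refine .inr (.inr ⟨by simp, h2.symm, fun C hC => ?_⟩)
          obtain rfl : C = _ := hC
          exact .inl h3
        · exact .inl hm
      | newView C h1 h2 h3 h4 h5 =>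
        simp [Config.update, Config.broadcast, Local.sign] at hm
        rcases hm with rfl | hm
        · refine .inr (.inr ⟨?_, h2.symm, fun C hC => ?_⟩)
          · simp [Config.update, Config.broadcast, Local.sign]
          · obtain rfl : C = _ := hC
            exact .inl h5.1
        · exact .inl hm
      | blame =>
        simp [Config.update, Config.broadcast, Local.sign] at hm
        rcases hm with rfl | hm
        · refine .inr (.inr ⟨?_, rfl, fun C hC => hC.elim⟩)
          simp [Config.update, Config.broadcast, Local.sign]
        · exact .inl hm
    · left
      cases h <;> simpa [Config.update, Config.broadcast, Local.sign, hq] using hm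

/-! ### Invariants of reachable states -/

/-- Votes of honest nodes that are known somewhere, and those in known certificates, were signed. -/
theorem Setup.Reachable.log_sound {S : Setup f F D} {c : Config f F D} (hc : S.Reachable c)
    {q : Node f} {m : Msg f F D} (hm : m ∈ (c.node q).log) :
    (∀ C ∈ m.certs, S.Supported c C) ∧
      ∀ r x v, m = .vote r x v → r ∈ S.honest → m ∈ (c.node r).signed := by
  induction hc generalizing q m with
  | refl => exact hm.elim
  | tail _ hs ih =>
    rcases hs.log_cases hm with h | h | ⟨h1, h2, h3⟩
    · exact ⟨fun C hC => ((ih h).1 C hC).mono hs.mono,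
        fun r x v e hr => hs.mono.signed r ((ih h).2 r x v e hr)⟩
    · refine ⟨fun C hC r hr hr' => hs.mono.signed r
        (h _ (.inr ⟨C, hC, r, hr, rfl⟩) hr'), ?_⟩
      rintro r x v rfl hr
      exact hs.mono.signed r (h _ (.inl (.inl rfl)) hr)
    · refine ⟨fun C hC => ?_, ?_⟩
      · refine Setup.Supported.mono hs.mono ?_
        rcases h3 C hC with ⟨_, rfl | ⟨m', hm', h'⟩ | h'⟩ | ⟨m', hm', h'⟩
        -- The initial certificate has no signers and is supported vacuously.
        · exact fun r hr => absurd hr (Finset.notMem_empty r)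
        · exact (ih hm').1 C h'
        · exact fun r hr hr' => (ih (h' r hr)).2 r _ _ rfl hr'
        · exact (ih hm').1 C h'
      · rintro r x v rfl _
        obtain rfl : r = q := h2
        exact h1

/-! ### Data availability behind honest votes -/

/-- `x` is a chain and the complete blocks behind it are held by honest nodes. -/
def Setup.Backed (S : Setup f F D) (c : Config f F D) (x : Tip D) : Prop :=
  S.Chain x ∧ ∀ I, S.Extends x (some I) → ∃ q ∈ S.honest, ∃ B, S.Holds c q I B

theorem Setup.Backed.mono {S : Setup f F D} {c c' : Config f F D} (h : Mono c c')
    {x : Tip D} (hx : S.Backed c x) : S.Backed c' x :=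
  ⟨hx.1, fun I hI => (hx.2 I hI).imp fun q hq => ⟨hq.1, hq.2.imp fun _ hB =>
    ⟨h.store q hB.1, hB.2⟩⟩⟩

theorem Setup.backed_none (S : Setup f F D) (c : Config f F D) : S.Backed c none := by
  refine ⟨.nil, fun I hI => ?_⟩
  rcases Relation.ReflTransGen.cases_head hI with h | ⟨_, ⟨_, h, _⟩, _⟩ <;> cases h

theorem Setup.backed_cons {S : Setup f F D} (hS : Function.Injective S.hash) {c : Config f F D}
    {I : IdBlock D} {y : Tip D} (hy : S.Backed c y) (hp : I.prev = S.ref y)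
    (hh : I.height = tipHeight y + 1) (hI : ∃ q ∈ S.honest, ∃ B, S.Holds c q I B) :
    S.Backed c (some I) := by
  refine ⟨.cons I y hp hh hy.1, fun J hJ => ?_⟩
  rcases Relation.ReflTransGen.cases_head hJ with h | ⟨z, hz, hzJ⟩
  · cases h; exact hI
  · obtain rfl := S.contains_rightUnique hS hz ⟨I, rfl, hp⟩
    exact hy.2 J hzJ

theorem Setup.Supported.backed {S : Setup f F D} (hbyz : S.honestᶜ.card ≤ f) {c : Config f F D}
    (h : ∀ q x v, Msg.vote q x v ∈ (c.node q).signed → S.Backed c x)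
    {C : Cert f D} (hC : S.Supported c C) (hv : C.Valid) : S.Backed c C.block := by
  rcases hv.exists_honest hbyz with rfl | ⟨r, hr, hr'⟩
  · exact S.backed_none c
  · exact h _ _ _ (hC r hr hr')

/-- A vote after decoding is cast by a node that stores the block, and the certificate in the
proposal contains an earlier honest vote that backs the predecessors. A vote at view-start stores
nothing new, but repeats a certified block already backed by an earlier honest vote. Initial
certificates only concern `⊥`. -/
theorem Setup.Reachable.backed_of_vote {S : Setup f F D} (hbyz : S.honestᶜ.card ≤ f)
    (hS : Function.Injective S.hash) {c : Config f F D} (hc : S.Reachable c)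
    {q : Node f} {x : Tip D} {v : ℕ} (h : Msg.vote q x v ∈ (c.node q).signed) :
    S.Backed c x := by
  induction hc generalizing q x v with
  | refl => exact h.elim
  | @tail c c' hc hs ih =>
    have key : ∀ {m : Msg f F D} {C : Cert f D}, m ∈ (c.node q).log → C ∈ m.certs → C.Valid →
        S.Backed c' C.block := fun hm hC hv =>
      (((Setup.Reachable.log_sound hc hm).1 _ hC).backed hbyz (fun _ _ _ => ih) hv).mono hs.mono
    rcases hs.vote_cases h with h | ⟨hq, _, _, _, ⟨ps, I, B, rfl, h1, h2, h3, _, h4⟩ |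
      ⟨N, rfl, h1, h2, _⟩⟩
    · exact (ih h).mono hs.mono
    · obtain ⟨P, hP, hl, _, rfl⟩ := h2.exists_mem
      exact Setup.backed_cons hS (key (h1 P hP) rfl hl.1) hl.2.2.1 hl.2.2.2 ⟨q, hq, B, h4, h3.2⟩
    · exact key h1 rfl h2

/-- The block of a valid certificate that some node knows is backed. -/
theorem Setup.Reachable.backed_of_cert {S : Setup f F D} (hbyz : S.honestᶜ.card ≤ f)
    (hS : Function.Injective S.hash) {c : Config f F D} (hc : S.Reachable c)
    {q : Node f} {m : Msg f F D} (hm : m ∈ (c.node q).log) {C : Cert f D} (hC : C ∈ m.certs)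
    (hv : C.Valid) : S.Backed c C.block :=
  ((hc.log_sound hm).1 C hC).backed hbyz (fun _ _ _ h => hc.backed_of_vote hbyz hS h) hv

/-- The block of a legal leader message that some node knows is a chain. -/
theorem Setup.Reachable.chain_of_legal {S : Setup f F D} (hbyz : S.honestᶜ.card ≤ f)
    (hS : Function.Injective S.hash) {c : Config f F D} (hc : S.Reachable c)
    {q : Node f} {a : LeaderMsg f F D} (hm : Msg.lead a ∈ (c.node q).log) (ha : S.Legal a) :
    S.Chain a.block := by
  cases a with
  | prop P => exact .cons _ _ ha.2.2.1 ha.2.2.2 (hc.backed_of_cert hbyz hS hm rfl ha.1).1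
  | newView N => exact (hc.backed_of_cert hbyz hS hm rfl ha).1

/-- In the absence of evidence legal leader messages of the current view are comparable. -/
theorem Setup.Active.comparable {S : Setup f F D} {c : Config f F D} {q : Node f}
    (h : S.Active c q) {a b : LeaderMsg f F D} (ha : Msg.lead a ∈ (c.node q).log)
    (hb : Msg.lead b ∈ (c.node q).log) (hla : S.Legal a) (hlb : S.Legal b)
    (hva : a.view = (c.node q).view) (hvb : b.view = (c.node q).view) :
    S.Comparable a.block b.block := by
  by_contra hn
  rw [Setup.Comparable, not_or] at hn
  refine h.1 ⟨.equivocation a b, ⟨hla, hlb, hva, hvb, hn⟩, ?_⟩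
  rintro _ (rfl | rfl) <;> assumption

/-! ### Timing of deliveries, votes and view changes -/

/-- Synchrony: messages sent more than `Δ` ago have been received. -/
theorem Setup.Reachable.delivered {S : Setup f F D} (hΔ : 0 < S.Δ) {c : Config f F D}
    (hc : S.Reachable c) {q : Node f} (hq : q ∈ S.honest) {m : Msg f F D} {s : ℝ}
    (hm : (q, m, s) ∈ c.net) (hs : s + S.Δ < c.clock) : m ∈ (c.node q).log := by
  induction hc with
  | refl => exact hm.elim
  | @tail c c' hc h ih =>
    -- Only `tick` moves the clock, and it demands the delivery itself. In any other step a newly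
    -- sent message bears the current time, so it is not yet overdue.
    have key : c'.clock = c.clock → m ∈ (c'.node q).log := fun e => by
      rcases h.mono.net_new _ hm with h' | h'
      · exact h.mono.log q (ih h' (e ▸ hs))
      · have := h'.1
        simp only at this
        linarith
    cases h with
    | tick t ht h1 h2 h3 => exact h3 q hq m s hm hs
    | deliver => exact key rfl
    | react _ _ _ h => exact key (by cases h <;> rfl)
    | initiate _ _ _ h => exact key (by cases h <;> rfl)

theorem Setup.Reachable.sent_of_fwd {S : Setup f F D} {c : Config f F D} (hc : S.Reachable c)
    {q : Node f} {P : Proposal f F D} (hP : Msg.prop P ∈ (c.node q).fwd) :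
    S.Legal (.prop P) ∧ Msg.prop P ∈ (c.node q).log ∧
      ∃ s ≤ c.clock, ∀ i, (i, Msg.prop P, s) ∈ c.net := by
  induction hc with
  | refl => exact hP.elim
  | @tail c c' hc h ih =>
    rcases h.fwd_cases hP with h1 | ⟨h1, h2, h3⟩
    · obtain ⟨h1, h2, s, h3, h4⟩ := ih h1
      exact ⟨h1, h.mono.log q h2, s, h3.trans h.mono.clock, fun i => h.mono.net (h4 i)⟩
    · exact ⟨h1, h.mono.log q h2, _, h.mono.clock, h3⟩

/-- Recovers from a timer the starting time `t` and the broadcast of the proposal that started it.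
The proposal is of the current view, since timers do not survive a view change. -/
theorem Setup.Reachable.timer {S : Setup f F D} {c : Config f F D} (hc : S.Reachable c)
    {q : Node f} {x : Tip D} {T : ℝ} (hT : (x, T) ∈ (c.node q).timers) :
    ∃ P, S.Legal (.prop P) ∧ P.view = (c.node q).view ∧ Msg.prop P ∈ (c.node q).log ∧
      P.cert.block = x ∧ ∃ t, T = t + 2 * S.Δ ∧ ∀ i, (i, Msg.prop P, t) ∈ c.net := by
  induction hc with
  | refl => exact hT.elim
  | @tail c c' hc h ih =>
    rcases h.timer_cases hT with ⟨h1, h2⟩ | ⟨P, h1, h2, h3, h4, h5, h6⟩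
    · obtain ⟨P, h3, h4, h5, h6, t, h7, h8⟩ := ih h1
      exact ⟨P, h3, h4.trans h2.symm, h.mono.log q h5, h6, t, h7, fun i => h.mono.net (h8 i)⟩
    · exact ⟨P, h1, h2, h.mono.log q h3, h4, _, h5, h6⟩

/-- An honest vote is for the block of a legal leader message that the voter has sent to all nodes
by then, and that is comparable with all messages of the view due by then. -/
theorem Setup.Reachable.vote_time {S : Setup f F D} (hbyz : S.honestᶜ.card ≤ f)
    (hS : Function.Injective S.hash) (hΔ : 0 < S.Δ) {c : Config f F D} (hc : S.Reachable c)
    {q : Node f} {x : Tip D} {v : ℕ} (h : Msg.vote q x v ∈ (c.node q).signed) :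
    ∃ a : LeaderMsg f F D, a.block = x ∧ a.view = v ∧ S.Legal a ∧ ∃ s s', s ≤ s' ∧ s' ≤ c.clock ∧
      (∀ i, (i, Msg.lead a, s) ∈ c.net) ∧
      ∀ b t, (q, Msg.lead b, t) ∈ c.net → t + S.Δ < s' → S.Legal b → b.view = v →
        S.Comparable x b.block := by
  induction hc with
  | refl => exact h.elim
  | @tail c c' hc hs ih =>
    rcases hs.vote_cases h with h | ⟨hq, hA, rfl, hclk, h⟩
    · obtain ⟨a, h1, h2, h3, s, s', h4, h5, h6, h7⟩ := ih h
      refine ⟨a, h1, h2, h3, s, s', h4, h5.trans hs.mono.clock, fun i => hs.mono.net (h6 i),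
        fun b t hb ht => h7 b t ?_ ht⟩
      refine (hs.mono.net_new _ hb).resolve_right fun h => ?_
      have := h.1
      simp only at this
      linarith
    · have old : ∀ b t, (q, Msg.lead b, t) ∈ c'.net → t + S.Δ < c.clock →
          Msg.lead b ∈ (c.node q).log := fun b t hb ht => by
        refine Setup.Reachable.delivered hΔ hc hq
          ((hs.mono.net_new _ hb).resolve_right fun h => ?_) ht
        have := h.1
        simp only at this
        linarith
      rcases h with ⟨ps, I, B, rfl, h1, h2, h3, ⟨P', h4, h5, h6⟩, _⟩ | ⟨N, rfl, h1, h2, h3, _, h4⟩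
      · obtain ⟨P, hP, hl, hv, rfl⟩ := h2.exists_mem
        obtain ⟨hl', hlog, s, hs1, hs2⟩ := Setup.Reachable.sent_of_fwd hc h4
        -- The forwarded proposal need not be one of those decoded; without equivocation, equal
        -- heights force equal blocks. So `s` is the time of forwarding, and `s'` the time of the
        -- vote.
        have he : some P'.block = some P.block :=
          (hA.comparable hlog (h1 P hP) hl' hl h5 hv).eq_of_height hS
            (Setup.Reachable.chain_of_legal hbyz hS hc hlog hl')
            (Setup.Reachable.chain_of_legal hbyz hS hc (h1 P hP) hl) h6
        exact ⟨.prop P', he, h5, hl', s, c.clock, hs1, hclk.ge, fun i => hs.mono.net (hs2 i),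
          fun b t hb ht hbl hbv => hA.comparable (h1 P hP) (old b t hb ht) hl hbl hv hbv⟩
      · exact ⟨.newView N, rfl, h3, h2, c.clock, c.clock, le_rfl, hclk.ge, h4,
          fun b t hb ht hbl hbv => hA.comparable h1 (old b t hb ht) h2 hbl h3 hbv⟩

/-- A node that has left view `v` has sent evidence to all nodes, and its lock is at least as high as
all certificates due when it left the view. -/
theorem Setup.Reachable.leave_time {S : Setup f F D} (hΔ : 0 < S.Δ) {c : Config f F D}
    (hc : S.Reachable c) {q : Node f} {v : ℕ} (h : v < (c.node q).view) :
    ∃ p ε s, S.Proves v ε ∧ s ≤ c.clock ∧ (∀ i, (i, Msg.quit p ε v, s) ∈ c.net) ∧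
      ∀ m t, (q, m, t) ∈ c.net → t + S.Δ < s → m ∈ (c.node q).log ∧
        ∀ C ∈ m.certs, C.Valid → C.rank ≤ (c.node q).lock.rank := by
  induction hc with
  | refl => exact absurd h (Nat.not_lt_zero v)
  | @tail c c' hc hs ih =>
    have old : ∀ {m : Msg f F D} {t s : ℝ}, (q, m, t) ∈ c'.net → t + S.Δ < s → s ≤ c.clock →
        (q, m, t) ∈ c.net := fun hm ht hsc => by
      refine (hs.mono.net_new _ hm).resolve_right fun h => ?_
      have := h.1
      simp only at this
      linarith
    rcases hs.view_cases q with ⟨h1, h2⟩ | ⟨hq, h1, h2, p, ε, h3, h4⟩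
    · obtain ⟨p, ε, s, h3, h4, h5, h6⟩ := ih (h1 ▸ h)
      refine ⟨p, ε, s, h3, h4.trans hs.mono.clock, fun i => hs.mono.net (h5 i), fun m t hm ht => ?_⟩
      obtain ⟨h7, h8⟩ := h6 m t (old hm ht h4) ht
      exact ⟨hs.mono.log q h7, h2 ▸ h8⟩
    · have key : ∀ {m : Msg f F D}, m ∈ (c.node q).log → m ∈ (c'.node q).log ∧
          ∀ C ∈ m.certs, C.Valid → C.rank ≤ (c'.node q).lock.rank := fun {m} hm =>
        ⟨hs.mono.log q hm, fun C hC hv => h2.2 C ⟨hv, .inr (.inl ⟨m, hm, hC⟩)⟩⟩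
      -- Either `v` was left earlier, and the new lock is again highest for a log that still
      -- contains the messages in question, or `v` is the view left now, at time `c.clock`.
      rcases (Nat.lt_succ_iff.1 (h1 ▸ h)).lt_or_eq with h | rfl
      · obtain ⟨p, ε, s, h3, h4, h5, h6⟩ := ih h
        exact ⟨p, ε, s, h3, h4.trans hs.mono.clock, fun i => hs.mono.net (h5 i),
          fun m t hm ht => key (h6 m t (old hm ht h4) ht).1⟩
      · exact ⟨p, ε, c.clock, h3, hs.mono.clock, h4, fun m t hm ht =>
          key (Setup.Reachable.delivered hΔ hc hq (old hm ht le_rfl) ht)⟩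

/-! ### Safety of a commit -/

/-- What protects the block certified in the proposal `P` against conflicting commits. -/
structure Setup.Guard (S : Setup f F D) (c : Config f F D) (P : Proposal f F D) : Prop where
  legal : S.Legal (.prop P)
  nonempty : S.honest.Nonempty
  log : ∀ q ∈ S.honest, Msg.prop P ∈ (c.node q).log
  lock : ∀ q ∈ S.honest, P.view < (c.node q).view → P.cert.rank ≤ (c.node q).lock.rank
  comparable : ∀ q ∈ S.honest, ∀ x, Msg.vote q x P.view ∈ (c.node q).signed →
    S.Comparable x (some P.block)
  extends_of_lt : ∀ q ∈ S.honest, ∀ x v, P.view < v → Msg.vote q x v ∈ (c.node q).signed →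
    S.Extends x P.cert.block

/-- A proposal of a later view builds on a certificate of that view, hence on an earlier honest vote
covered by `ext`. A new-view certificate ranks at least as high as `P.cert`: from a later view it is
again covered by `ext`; from the view of `P`, comparability and height decide. The hypotheses are
weaker than `Guard` because states before the commit, where `P` need not be known to all, are needed
too. -/
theorem Step.extends_of_lt {S : Setup f F D} (hbyz : S.honestᶜ.card ≤ f)
    (hS : Function.Injective S.hash) {c c' : Config f F D} (hc : S.Reachable c)
    (hs : Step S c c') {P : Proposal f F D} (hl : S.Legal (.prop P)) (hP : S.Chain P.cert.block)
    (lock : ∀ q ∈ S.honest, P.view < (c.node q).view → P.cert.rank ≤ (c.node q).lock.rank)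
    (comparable : ∀ q ∈ S.honest, ∀ x, Msg.vote q x P.view ∈ (c.node q).signed →
      S.Comparable x (some P.block))
    (ext : ∀ q ∈ S.honest, ∀ x v, P.view < v → Msg.vote q x v ∈ (c.node q).signed →
      S.Extends x P.cert.block)
    {q : Node f} {x : Tip D} {v : ℕ} (hq : q ∈ S.honest) (hv : P.view < v)
    (h : Msg.vote q x v ∈ (c'.node q).signed) : S.Extends x P.cert.block := by
  rcases hs.vote_cases h with h | ⟨-, -, rfl, -, ⟨ps, I, B, rfl, h1, h2, -⟩ |
    ⟨N, rfl, h1, h2, h3, h4, -⟩⟩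
  · exact ext q hq x v hv h
  · obtain ⟨P0, hP0, hl0, hv0, rfl⟩ := h2.exists_mem
    refine .head hl0.contains ?_
    have hview : P0.cert.view = (c.node q).view := hl0.2.1.trans hv0
    rcases hl0.1.exists_honest hbyz with h0 | ⟨r, hr, hr'⟩
    · rw [h0] at hview
      exact absurd hv (by rw [← hview]; exact Nat.not_lt_zero _)
    · exact ext r hr' _ _ (hview ▸ hv) ((hc.log_sound (h1 P0 hP0)).1 _ rfl r hr hr')
  · have hrank := (lock q hq hv).trans h4
    have hvN : N.cert.Valid := h2
    rw [Cert.rank, Cert.rank, Prod.Lex.toLex_le_toLex, hl.2.1] at hrank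
    rcases hvN.exists_honest hbyz with h0 | ⟨r, hr, hr'⟩
    -- The initial certificate has the least rank `(0, 0)`, so the block certified in `P` must be
    -- `⊥` as well.
    · rw [h0] at hrank ⊢
      rcases hrank with h | ⟨-, h⟩
      · exact absurd h (Nat.not_lt_zero _)
      · rw [hP.eq_none (Nat.le_zero.1 h)]
        exact .refl
    · have hvote := (hc.log_sound h1).1 N.cert rfl r hr hr'
      rcases hrank with h | ⟨he, h⟩
      · exact ext r hr' _ _ h hvote
      · simp only at he
        exact ((comparable r hr' _ (he ▸ hvote)).of_contains hS hl.contains).extends_of_le hS hP h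

/-- Timing no longer matters: a node that knows `P` locks at least `P.cert` on leaving any view, and
while active in the view of `P` it votes only for blocks comparable with `P.block`. -/
theorem Setup.Guard.step {S : Setup f F D} (hbyz : S.honestᶜ.card ≤ f)
    (hS : Function.Injective S.hash) {c c' : Config f F D} (hc : S.Reachable c)
    (hs : Step S c c') {P : Proposal f F D} (h : S.Guard c P) : S.Guard c' P where
  legal := h.legal
  nonempty := h.nonempty
  log q hq := hs.mono.log q (h.log q hq)
  lock q hq hv := by
    rcases hs.view_cases q with ⟨h1, h2⟩ | ⟨_, _, h2, _⟩
    · rw [h2]; exact h.lock q hq (h1 ▸ hv)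
    · exact h2.2 _ ⟨h.legal.1, .inr (.inl ⟨_, h.log q hq, rfl⟩)⟩
  comparable q hq x hx := by
    rcases hs.vote_cases hx with h' | ⟨-, hA, hv, -, ⟨ps, I, B, rfl, h1, h2, -⟩ |
      ⟨N, rfl, h1, h2, h3, -⟩⟩
    · exact h.comparable q hq x h'
    · obtain ⟨P0, hP0, hl0, hv0, rfl⟩ := h2.exists_mem
      exact hA.comparable (h1 P0 hP0) (h.log q hq) hl0 h.legal hv0 hv
    · exact hA.comparable h1 (h.log q hq) h2 h.legal h3 hv
  extends_of_lt q hq x v hv hx := by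
    obtain ⟨r, hr⟩ := h.nonempty
    exact hs.extends_of_lt hbyz hS hc h.legal
      (hc.backed_of_cert hbyz hS (h.log r hr) rfl h.legal.1).1 h.lock h.comparable
      h.extends_of_lt hq hv hx

/-- This is where the length `2Δ` of the timer is used: what is sent by `t + Δ` reaches `r` before
it commits, and what happens after `t + Δ` happens at nodes that know `P`. -/
theorem Setup.Reachable.guard_of_timer {S : Setup f F D} (hbyz : S.honestᶜ.card ≤ f)
    (hS : Function.Injective S.hash) (hΔ : 0 < S.Δ) {c : Config f F D} (hc : S.Reachable c)
    {r : Node f} (hr : r ∈ S.honest) (hA : S.Active c r) {x : Tip D}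
    (hx : (x, c.clock) ∈ (c.node r).timers)
    (hdue : ∀ m t, (r, m, t) ∈ c.net → t + S.Δ ≤ c.clock → m ∈ (c.node r).log) :
    ∃ P, S.Guard c P ∧ P.cert.block = x := by
  obtain ⟨P, hl, hv, hlog, rfl, t, ht, hsent⟩ := hc.timer hx
  have hlater : ∀ {p : Node f} {ε : Evidence f F D} {s : ℝ}, S.Proves P.view ε →
      (∀ i, (i, Msg.quit p ε P.view, s) ∈ c.net) → t + S.Δ < s := fun {p ε s} hε hs => by
    by_contra! hle
    have := hdue _ s (hs r) (by linarith)
    rw [hv] at this hε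
    exact hA.2 ⟨p, ε, this, hε⟩
  have hlock : ∀ c', S.Reachable c' → Mono c' c → ∀ q ∈ S.honest, P.view < (c'.node q).view →
      P.cert.rank ≤ (c'.node q).lock.rank := fun c' hc' hm q hq hlt => by
    obtain ⟨p, ε, s, h1, h2, h3, h4⟩ := hc'.leave_time hΔ hlt
    have hts := hlater h1 fun i => hm.net (h3 i)
    -- `P` had already been sent in `c'`: otherwise `t ≥ c'.clock ≥ s > t + Δ`.
    refine (h4 (.prop P) t ((hm.net_new _ (hsent q)).resolve_right fun h => ?_) hts).2 _ rfl hl.1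
    have := h.1
    simp only at this
    linarith
  have hcomp : ∀ q ∈ S.honest, ∀ x, Msg.vote q x P.view ∈ (c.node q).signed →
      S.Comparable x (some P.block) := fun q hq x hx => by
    obtain ⟨a, rfl, h2, h3, s, s', h4, h5, h6, h7⟩ := hc.vote_time hbyz hS hΔ hx
    -- Either `r` has received the leader message behind the vote and would have noticed a conflict,
    -- or `s > t + Δ` and the voter knew `P` when voting.
    rcases le_or_gt (s + S.Δ) c.clock with h | h
    · exact hA.comparable (hdue _ s (h6 r) h) hlog h3 hl (h2.trans hv) hv
    · exact h7 (.prop P) t (hsent q) (by linarith) hl rfl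
  -- Votes of later views may precede the commit, so the induction runs over all prefixes of the
  -- execution. The bounds `hlock` and `hcomp` hold in each of them.
  have hext : ∀ c', S.Reachable c' → Relation.ReflTransGen (Step S) c' c →
      ∀ q ∈ S.honest, ∀ x v, P.view < v → Msg.vote q x v ∈ (c'.node q).signed →
        S.Extends x P.cert.block := fun c' hc' => by
    induction hc' with
    | refl => exact fun _ _ _ _ _ _ h => h.elim
    | @tail a b ha hs ih =>
      intro hb q hq x v hlt hvote
      have hm := (hs.mono.trans (mono_of_steps hb))
      exact hs.extends_of_lt hbyz hS ha hl (hc.backed_of_cert hbyz hS hlog rfl hl.1).1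
        (hlock a ha hm) (fun q hq x hx => hcomp q hq x (hm.signed q hx))
        (ih (.head hs hb)) hq hlt hvote
  exact ⟨P, ⟨hl, ⟨r, hr⟩, fun q hq => hc.delivered hΔ hq (hsent q) (by linarith),
    hlock c hc (.refl c), hcomp, hext c hc .refl⟩, rfl⟩

theorem Setup.Reachable.guard_of_direct {S : Setup f F D} (hbyz : S.honestᶜ.card ≤ f)
    (hS : Function.Injective S.hash) (hΔ : 0 < S.Δ) {c : Config f F D} (hc : S.Reachable c)
    {r : Node f} {x : Tip D} (hx : x ∈ (c.node r).direct) :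
    ∃ P, S.Guard c P ∧ P.cert.block = x := by
  induction hc with
  | refl => exact hx.elim
  | @tail c c' hc hs ih =>
    have : ∃ P, S.Guard c P ∧ P.cert.block = x := by
      rcases hs.direct_cases hx with h | ⟨h1, h2, h3, h4⟩
      · exact ih h
      · exact Setup.Reachable.guard_of_timer hbyz hS hΔ hc h1 h2 h3 h4
    exact this.imp fun P h => ⟨h.1.step hbyz hS hc hs, h.2⟩

/-- An honest vote in `P'.cert` is cast in the view of `P'`, so the guard of `P` applies to it: as a
later vote if the views differ, and as a vote comparable with `P.block` if they agree. -/
theorem Setup.Guard.comparable_of_le {S : Setup f F D} (hbyz : S.honestᶜ.card ≤ f)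
    (hS : Function.Injective S.hash) {c : Config f F D} (hc : S.Reachable c)
    {P P' : Proposal f F D} (h : S.Guard c P) (h' : S.Guard c P') (hle : P.view ≤ P'.view) :
    S.Comparable P'.cert.block P.cert.block := by
  obtain ⟨q, hq⟩ := h.nonempty
  have hP := (hc.backed_of_cert hbyz hS (h.log q hq) rfl h.legal.1).1
  rcases h'.legal.1.exists_honest hbyz with h0 | ⟨r, hr, hr'⟩
  · rw [h0]
    exact .inr hP.extends_none
  · have hvote := (hc.log_sound (h'.log q hq)).1 _ rfl r hr hr'
    have hview : P'.cert.view = P'.view := h'.legal.2.1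
    rcases hle.lt_or_eq with hlt | he
    · exact .inl (h.extends_of_lt r hr' _ _ (hview ▸ hlt) hvote)
    · exact (h.comparable r hr' _ (he ▸ hview ▸ hvote)).of_contains hS h.legal.contains

end Hamster

/-- Weak safety of Hamster under standard synchrony. -/
theorem mainTheorem1 {f : ℕ} {F D : Type*} [Field F] (S : Hamster.Setup f F D)
    (hΔ : 0 < S.Δ) (hbyz : S.honestᶜ.card ≤ f) (hmds : S.MDS)
    (hhash : Function.Injective S.hash)
    (c : Hamster.Config f F D) (hc : S.Reachable c) :
    (∀ r ∈ S.honest, ∀ r' ∈ S.honest, ∀ I I' : Hamster.IdBlock D,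
      S.Committed c r I → S.Committed c r' I' → I.height = I'.height → I = I') ∧
    (∀ r ∈ S.honest, ∀ I : Hamster.IdBlock D, S.Committed c r I →
      ∃ q ∈ S.honest, ∃ B : Hamster.Block f F, S.Holds c q I B) := by
  have backed : ∀ {P}, S.Guard c P → S.Backed c P.cert.block := fun {P} h => by
    obtain ⟨q, hq⟩ := h.nonempty
    exact hc.backed_of_cert hbyz hhash (h.log q hq) rfl h.legal.1
  constructor
  · rintro r - r' - I I' ⟨x, hx, hI⟩ ⟨x', hx', hI'⟩ he
    obtain ⟨P, hP, rfl⟩ := hc.guard_of_direct hbyz hhash hΔ hx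
    obtain ⟨P', hP', rfl⟩ := hc.guard_of_direct hbyz hhash hΔ hx'
    have hcomp : S.Comparable P.cert.block P'.cert.block := by
      rcases le_total P.view P'.view with h | h
      · exact (hP.comparable_of_le hbyz hhash hc hP' h).symm
      · exact hP'.comparable_of_le hbyz hhash hc hP h
    -- Comparability descends from the direct commits to the blocks they extend.
    have := ((hcomp.of_extends hhash hI').symm.of_extends hhash hI).eq_of_height hhash
      ((backed hP').1.of_extends hhash hI').1 ((backed hP).1.of_extends hhash hI).1 he.symm
    exact (Option.some.inj this).symm
  · rintro r - I ⟨x, hx, hI⟩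
    obtain ⟨P, hP, rfl⟩ := hc.guard_of_direct hbyz hhash hΔ hx
    exact (backed hP).2 I hI
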